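/- Let $k,n\ge 0$ be integers, and let $[k]^n=\{0,1,\dots,k-1\}^n$. For $x=x_1\dots x_n\in[k]^n$ and an integer $i\ge 0$ put $R_i(x)=\{j : x_j=i\}$. Define an order $\le$ on $[k]^n$ by setting $x\le y$ if $x=y$ or one of the following holds: (1) $|R_0(x)|>|R_0(y)|$; (2) $|R_0(x)|=|R_0(y)|$, and for the largest $i$ with $R_i(x)\ne R_i(y)$ we have $\max\bigl(R_i(x)\,\Delta\,R_i(y)\bigr)\in R_i(y)$. An initial segment of this order is a set $B\subseteq[k]^n$ such that $y\in B$ and $x\le y$ imply $x\in B$. The $d$-shadow $d(A)$ of a set $A\subseteq[k]^n$ is the set of all points obtained from some point of $A$ by changing exactly one of its nonzero coordinates to $0$. Theorem. Let $A\subseteq[k]^n$, and let $B$ be an initial segment of the order $\le$ on $[k]^n$ with $|B|=|A|$. Then $|d(A)|\ge|d(B)|$. -/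

import Mathlib

namespace KGrid

/-- The grid `[k]^n = {0, …, k-1}^n`. Coordinates are indexed by `Fin n`. -/
abbrev Grid (k n : ℕ) : Type := Fin n → Fin k

/-- `R_i(x)`, the set of positions at which `x` has the value `i`. -/
def R {k n : ℕ} (i : ℕ) (x : Grid k n) : Finset (Fin n) :=
  Finset.univ.filter fun j => (x j : ℕ) = i

/-- The strict binary order on finite sets of positions:
`X` comes before `Y` if the symmetric difference has a maximum, and it lies in `Y`. -/
def BinLT {n : ℕ} (X Y : Finset (Fin n)) : Prop :=
  ∃ m, IsGreatest (↑(symmDiff X Y) : Set (Fin n)) m ∧ m ∈ Y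

/-- The order on `[k]^n`: first by decreasing number of zeros, then by comparing, in the
binary order, `R_i(x)` and `R_i(y)` for the largest `i` for which they differ. -/
def GridLE {k n : ℕ} (x y : Grid k n) : Prop :=
  x = y ∨ (R 0 x).card > (R 0 y).card ∨
    ((R 0 x).card = (R 0 y).card ∧
      ∃ i, IsGreatest {i : ℕ | R i x ≠ R i y} i ∧ BinLT (R i x) (R i y))

/-- Initial segments of the order on `[k]^n`. -/
def IsInitialSegment {k n : ℕ} (B : Finset (Grid k n)) : Prop :=
  ∀ y ∈ B, ∀ x : Grid k n, GridLE x y → x ∈ B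

/-- The `d`-shadow of a point: all points obtained from it by changing one nonzero
coordinate to `0`. -/
def pointShadow {k n : ℕ} (x : Grid k n) : Finset (Grid k n) :=
  (Finset.univ.filter fun j => (x j : ℕ) ≠ 0).image
    fun j => Function.update x j ⟨0, Fin.pos (x j)⟩

/-- The `d`-shadow of a set of points: the union of the `d`-shadows of its points. -/
def dShadow {k n : ℕ} (A : Finset (Grid k n)) : Finset (Grid k n) :=
  A.biUnion pointShadow

end KGrid

/-! The order is encoded by an injective numerical `key`. Within an induction on `n`, the proof
descends on the sum of keys over `A`: if `A` is not initial, some `A'` satisfies `Improves A' A`.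

Two compressions give improvements. If `A` is not closed under lowering a coordinate, a `shift`
applies. If a slice (one coordinate fixed) is not initial, all slices in that direction are replaced
by initial segments; the induction hypothesis and `IsInit.dShadow` (shadows of initial segments are
initial) control the shadow.

Otherwise let `x` be the first missing point and `y` the last point of `A`, with `x` before `y`
(`Gap`). Closure within slices forces `x` and `y` to differ at every position. Exchanging `y` for
`x` works unless `x` has a shadow point outside `dShadow A`; such a point comes from zeroing an
entry `x i = 1` with no zero of `x` before `i`. Intermediate points sharing one coordinate with `x`
and one with `y` rule this out, except when neither point has a zero, `i` is the top difference, `y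
i > 1`, and `x` exceeds `y` elsewhere. Then a line of points ending at `y` is exchanged for an
equally long line starting at `x`: at most one shadow point is gained, and one is lost. -/

namespace KGrid

open Finset Function

variable {k n : ℕ}

/-! ### The order as a numerical key -/

section Order

/-- The number of nonzero coordinates. -/
def rk (x : Grid (k + 1) n) : ℕ := #{j | x j ≠ 0}

/-- The nonzero coordinates of a point together with their values, encoded so that the natural
order compares values first and positions second. -/
def code (x : Grid (k + 1) n) : Finset ℕ :=
  ({j | x j ≠ 0} : Finset (Fin n)).image fun j => n * (x j : ℕ) + j

/-- A numerical key for the order on the grid. -/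
def key (x : Grid (k + 1) n) : ℕ := rk x * 2 ^ (n * (k + 1)) + ∑ e ∈ code x, 2 ^ e

lemma mul_add_lt_mul_add_iff {a b i j : ℕ} (hi : i < n) (hj : j < n) :
    n * a + i < n * b + j ↔ a < b ∨ a = b ∧ i < j := by
  rcases lt_trichotomy a b with h | rfl | h
  · have : n * (a + 1) ≤ n * b := Nat.mul_le_mul_left n h
    simp only [mul_add, mul_one] at this
    exact ⟨fun _ => Or.inl h, fun _ => by lia⟩
  · simp
  · have : n * (b + 1) ≤ n * a := Nat.mul_le_mul_left n h
    simp only [mul_add, mul_one] at this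
    constructor
    · intro; lia
    · rintro (h' | ⟨h', -⟩) <;> lia

lemma mem_code_iff {x : Grid (k + 1) n} {v : ℕ} {j : Fin n} :
    n * v + j ∈ code x ↔ x j ≠ 0 ∧ (x j : ℕ) = v := by
  simp only [code, mem_image, mem_filter, mem_univ, true_and]
  constructor
  · rintro ⟨i, hi, h⟩
    have h1 := mul_add_lt_mul_add_iff (a := (x i : ℕ)) (b := v) i.2 j.2
    have h2 := mul_add_lt_mul_add_iff (a := v) (b := (x i : ℕ)) j.2 i.2
    have hij : i = j := by ext; lia
    subst hij
    exact ⟨hi, by lia⟩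
  · rintro ⟨h, rfl⟩
    exact ⟨j, h, rfl⟩

lemma exists_of_mem_code {x : Grid (k + 1) n} {e : ℕ} (h : e ∈ code x) :
    ∃ j, x j ≠ 0 ∧ e = n * (x j : ℕ) + j := by
  simp only [code, mem_image, mem_filter, mem_univ, true_and] at h
  obtain ⟨j, hj, rfl⟩ := h
  exact ⟨j, hj, rfl⟩

/-- This bound is why rank outweighs the code in `key`. -/
lemma sum_code_lt (x : Grid (k + 1) n) : ∑ e ∈ code x, 2 ^ e < 2 ^ (n * (k + 1)) := by
  refine Nat.geomSum_lt le_rfl fun e he => ?_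
  obtain ⟨j, -, rfl⟩ := exists_of_mem_code he
  have : n * ((x j : ℕ) + 1) ≤ n * (k + 1) := Nat.mul_le_mul_left n (x j).2
  rw [mul_add] at this
  lia

lemma code_injective : Injective (code : Grid (k + 1) n → Finset ℕ) := by
  intro x y h
  ext j
  by_cases hx : x j = 0
  · by_cases hy : y j = 0
    · rw [hx, hy]
    · have := (mem_code_iff (x := y) (v := y j) (j := j)).2 ⟨hy, rfl⟩
      rw [← h, mem_code_iff] at this
      exact this.2
  · have := (mem_code_iff (x := x) (v := x j) (j := j)).2 ⟨hx, rfl⟩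
    rw [h, mem_code_iff] at this
    exact this.2.symm

lemma key_lt_of_rk_lt {x y : Grid (k + 1) n} (h : rk x < rk y) : key x < key y := by
  have h1 := sum_code_lt x
  have h2 : (rk x + 1) * 2 ^ (n * (k + 1)) ≤ rk y * 2 ^ (n * (k + 1)) := Nat.mul_le_mul_right _ h
  rw [add_mul] at h2
  unfold key
  lia

lemma rk_le_of_key_le {x y : Grid (k + 1) n} (h : key x ≤ key y) : rk x ≤ rk y := by
  by_contra h'
  exact absurd (key_lt_of_rk_lt (not_le.1 h')) (not_lt.2 h)

lemma key_injective : Injective (key : Grid (k + 1) n → ℕ) := by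
  intro x y h
  have hr : rk x = rk y := le_antisymm (rk_le_of_key_le h.le) (rk_le_of_key_le h.ge)
  have hs : ∑ e ∈ code x, 2 ^ e = ∑ e ∈ code y, 2 ^ e := by
    unfold key at h
    rw [hr] at h
    exact Nat.add_left_cancel h
  exact code_injective (Finset.geomSum_injective le_rfl hs)

/-- At equal rank, `x` precedes `y` if some coordinate is raised and everything above the
raised value agrees. -/
lemma key_lt_of_witness {x y : Grid (k + 1) n} (hr : rk x = rk y) (q : Fin n) (hq : x q < y q)
    (h : ∀ j, y q < x j ∨ x j = y q ∧ q < j → y j = x j) : key x < key y := by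
  unfold key
  rw [hr]
  refine Nat.add_lt_add_left ?_ _
  rw [geomSum_lt_geomSum_iff_toColex_lt_toColex le_rfl,
    Colex.toColex_lt_toColex_iff_exists_forall_lt]
  refine ⟨n * (y q : ℕ) + q, mem_code_iff.2 ⟨Fin.ne_zero_of_lt hq, rfl⟩, fun h' => ?_, ?_⟩
  · have := (mem_code_iff.1 h').2
    rw [Fin.lt_def] at hq
    lia
  · intro b hb hb'
    obtain ⟨j, hj, rfl⟩ := exists_of_mem_code hb
    rw [mul_add_lt_mul_add_iff j.2 q.2]
    by_contra hcon
    have hjq : y j ≠ x j := fun e => hb' (mem_code_iff.2 ⟨by rwa [e], by rw [e]⟩)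
    refine hjq (h j ?_)
    simp only [Fin.lt_def, Fin.ext_iff] at *
    by_cases hjq' : (j : ℕ) = q
    · have := Fin.ext hjq'
      subst this
      lia
    · lia

/-- The largest element of the symmetric difference of the codes lies in `code y` and encodes `q`.
Agreement covers entries of either point above `(y q, q)`; `Gap.top_bounds` needs both. -/
lemma exists_witness_of_key_lt {x y : Grid (k + 1) n} (hr : rk x = rk y) (h : key x < key y) :
    ∃ q, x q < y q ∧
      ∀ j, y q < x j ∨ x j = y q ∧ q < j ∨ y q < y j ∨ y j = y q ∧ q < j → y j = x j := by
  unfold key at h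
  rw [hr] at h
  replace h := Nat.lt_of_add_lt_add_left h
  rw [geomSum_lt_geomSum_iff_toColex_lt_toColex le_rfl,
    Colex.toColex_lt_toColex_iff_max'_mem] at h
  obtain ⟨hne, hmax⟩ := h
  set m := (symmDiff (code x) (code y)).max' (symmDiff_nonempty.2 hne) with hm
  have hmem : m ∈ symmDiff (code x) (code y) := max'_mem _ _
  have hle : ∀ e ∈ symmDiff (code x) (code y), e ≤ m := fun e he => le_max' _ _ he
  obtain ⟨q, hq0, hq⟩ := exists_of_mem_code hmax
  have hagree : ∀ e, m < e → (e ∈ code x ↔ e ∈ code y) := by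
    intro e he
    by_contra hc
    have := hle e (by rw [mem_symmDiff]; tauto)
    lia
  have key1 : ∀ j, y q < x j ∨ x j = y q ∧ q < j ∨ y q < y j ∨ y j = y q ∧ q < j → y j = x j := by
    intro j hj
    have hx : y q < x j ∨ x j = y q ∧ q < j → y j = x j := by
      intro h
      have h0 : x j ≠ 0 := by
        rcases h with h | h
        · exact Fin.ne_zero_of_lt h
        · rw [h.1]; exact hq0
      have : m < n * (x j : ℕ) + j := by
        rw [hq, mul_add_lt_mul_add_iff q.2 j.2]
        simp only [Fin.lt_def, Fin.ext_iff] at h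
        lia
      have := (mem_code_iff.1 ((hagree _ this).1 (mem_code_iff.2 ⟨h0, rfl⟩))).2
      exact Fin.ext this
    have hy : y q < y j ∨ y j = y q ∧ q < j → y j = x j := by
      intro h
      have h0 : y j ≠ 0 := by
        rcases h with h | h
        · exact Fin.ne_zero_of_lt h
        · rw [h.1]; exact hq0
      have : m < n * (y j : ℕ) + j := by
        rw [hq, mul_add_lt_mul_add_iff q.2 j.2]
        simp only [Fin.lt_def, Fin.ext_iff] at h
        lia
      have := (mem_code_iff.1 ((hagree _ this).2 (mem_code_iff.2 ⟨h0, rfl⟩))).2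
      exact (Fin.ext this).symm
    tauto
  refine ⟨q, ?_, key1⟩
  by_contra hcon
  rcases (not_lt.1 hcon).lt_or_eq with h | h
  · exact h.ne (key1 q (Or.inl h))
  · rw [mem_symmDiff] at hmem
    have : m ∈ code x := by
      rw [hq, mem_code_iff, ← h]
      exact ⟨hq0, rfl⟩
    tauto

lemma card_R_zero_add_rk (x : Grid (k + 1) n) : #(R 0 x) + rk x = n := by
  have h := card_filter_add_card_filter_not (s := (univ : Finset (Fin n))) fun j => x j = 0
  have h0 : R 0 x = ({j | x j = 0} : Finset (Fin n)) := by
    ext j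
    simp only [R, mem_filter, mem_univ, true_and, Fin.ext_iff, Fin.val_zero]
  rw [card_univ, Fintype.card_fin] at h
  rw [h0]
  exact h

/-- This direction suffices: it makes initial segments of the given order downward closed for `key`.
-/
lemma gridLE_of_key_lt {x y : Grid (k + 1) n} (h : key x < key y) : GridLE x y := by
  have hx := card_R_zero_add_rk x
  have hy := card_R_zero_add_rk y
  rcases (rk_le_of_key_le h.le).lt_or_eq with hr | hr
  · exact Or.inr (Or.inl (by lia))
  · obtain ⟨q, hq, hag⟩ := exists_witness_of_key_lt hr h
    have hqx : q ∉ R (y q : ℕ) x := by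
      simp only [R, mem_filter, mem_univ, true_and]
      exact hq.ne ∘ Fin.ext
    have hqy : q ∈ R (y q : ℕ) y := by simp [R]
    refine Or.inr (Or.inr ⟨by lia, (y q : ℕ), ⟨?_, ?_⟩, q, ⟨?_, ?_⟩, hqy⟩)
    · intro h'
      rw [h'] at hqx
      exact hqx hqy
    · intro i hi
      by_contra hlt
      refine hi ?_
      ext j
      simp only [R, mem_filter, mem_univ, true_and]
      constructor
      · intro h'
        rw [hag j (Or.inl (by rw [Fin.lt_def]; lia)), h']
      · intro h'
        rw [← hag j (Or.inr (Or.inr (Or.inl (by rw [Fin.lt_def]; lia)))), h']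
    · simp only [mem_coe, mem_symmDiff]
      tauto
    · intro j hj
      by_contra hlt
      simp only [mem_coe, mem_symmDiff, R, mem_filter, mem_univ, true_and, ← Fin.ext_iff] at hj
      rw [not_le] at hlt
      rcases hj with hj | hj
      · exact hj.2 ((hag j (Or.inr (Or.inl ⟨hj.1, hlt⟩))).trans hj.1)
      · exact hj.2 ((hag j (Or.inr (Or.inr (Or.inr ⟨hj.1, hlt⟩)))).symm.trans hj.1)

lemma rk_update_zero {x : Grid (k + 1) n} {i : Fin n} (hi : x i ≠ 0) :
    rk (update x i 0) + 1 = rk x := by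
  unfold rk
  have : ({j | update x i 0 j ≠ 0} : Finset (Fin n)) = ({j | x j ≠ 0} : Finset _).erase i := by
    ext j
    by_cases h : j = i
    · subst h; simp
    · simp [h]
  rw [this, card_erase_add_one (by simpa using hi)]

lemma rk_update_of_eq_zero {x : Grid (k + 1) n} {i : Fin n} {v : Fin (k + 1)} (hi : x i = 0)
    (hv : v ≠ 0) : rk (update x i v) = rk x + 1 := by
  have h := rk_update_zero (x := update x i v) (i := i) (by simpa using hv)
  rw [update_idem, ← hi, update_eq_self] at h
  exact h.symm

lemma rk_update_of_ne_zero {x : Grid (k + 1) n} {i : Fin n} {v : Fin (k + 1)} (hi : x i ≠ 0)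
    (hv : v ≠ 0) : rk (update x i v) = rk x := by
  rw [← rk_update_zero hi, ← rk_update_of_eq_zero (x := update x i 0) (i := i) (by simp) hv,
    update_idem]

lemma rk_update_update {x : Grid (k + 1) n} {a i : Fin n} {v : Fin (k + 1)} (ha : x a ≠ 0)
    (hi : x i = 0) (hv : v ≠ 0) : rk (update (update x a 0) i v) = rk x := by
  have hai : i ≠ a := by rintro rfl; exact ha hi
  rw [rk_update_of_eq_zero (by simpa [hai] using hi) hv, rk_update_zero ha]

/-- Lowering a coordinate to a smaller value makes a point smaller. -/
lemma key_update_lt {x : Grid (k + 1) n} {i : Fin n} {v : Fin (k + 1)} (h : v < x i) :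
    key (update x i v) < key x := by
  have hi : x i ≠ 0 := Fin.ne_zero_of_lt h
  by_cases hv : v = 0
  · subst hv
    exact key_lt_of_rk_lt (by have := rk_update_zero hi; lia)
  · refine key_lt_of_witness (rk_update_of_ne_zero hi hv) i (by simpa using h) fun j hj => ?_
    by_cases hji : j = i
    · subst hji
      simp only [update_self] at hj
      exact absurd hj (by simp [h.not_gt])
    · rw [update_of_ne hji]

lemma rk_insertNth (i : Fin (n + 1)) (v : Fin (k + 1)) (s : Grid (k + 1) n) :
    rk (i.insertNth v s : Grid (k + 1) (n + 1)) = (if v = 0 then 0 else 1) + rk s := by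
  unfold rk
  rw [card_filter, card_filter, Fin.sum_univ_succAbove _ i]
  simp

lemma key_insertNth_lt (i : Fin (n + 1)) (v : Fin (k + 1)) {s t : Grid (k + 1) n}
    (h : key s < key t) :
    key (i.insertNth v s : Grid (k + 1) (n + 1)) < key (i.insertNth v t : Grid (k + 1) (n + 1)) := by
  rcases (rk_le_of_key_le h.le).lt_or_eq with hr | hr
  · exact key_lt_of_rk_lt (by rw [rk_insertNth, rk_insertNth]; lia)
  · obtain ⟨q, hq, hag⟩ := exists_witness_of_key_lt hr h
    refine key_lt_of_witness (by rw [rk_insertNth, rk_insertNth, hr]) (i.succAbove q)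
      (by simpa using hq) fun j hj => ?_
    induction j using Fin.succAboveCases i with
    | x => simp
    | p j =>
      simp only [Fin.insertNth_apply_succAbove, Fin.succAbove_lt_succAbove_iff] at hj ⊢
      exact hag j (by tauto)

end Order

/-! ### Initial segments -/

section Segments

/-- Finite sets of points that are downward closed for `key`. -/
def IsInit (B : Finset (Grid (k + 1) n)) : Prop := ∀ y ∈ B, ∀ x, key x ≤ key y → x ∈ B

lemma IsInitialSegment.isInit {B : Finset (Grid (k + 1) n)} (hB : IsInitialSegment B) :
    IsInit B := by
  intro y hy x hxy
  rcases hxy.lt_or_eq with h | h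
  · exact hB y hy x (gridLE_of_key_lt h)
  · rwa [key_injective h]

lemma IsInit.subset_of_card_le {I J : Finset (Grid (k + 1) n)} (hI : IsInit I) (hJ : IsInit J)
    (h : #I ≤ #J) : I ⊆ J := by
  by_contra hc
  obtain ⟨x, hx, hxJ⟩ := not_subset.1 hc
  have hJI : J ⊆ I := fun y hy => hI x hx y <| by
    by_contra hlt
    exact hxJ (hJ y hy x (not_le.1 hlt).le)
  rw [eq_of_subset_of_card_le hJI h] at hxJ
  exact hxJ hx

lemma exists_isInit_card {m : ℕ} (hm : m ≤ Fintype.card (Grid (k + 1) n)) :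
    ∃ I : Finset (Grid (k + 1) n), IsInit I ∧ #I = m := by
  induction m with
  | zero => exact ⟨∅, by simp [IsInit], rfl⟩
  | succ m ih =>
    obtain ⟨I, hI, rfl⟩ := ih (by lia)
    have hne : Iᶜ.Nonempty := by
      rw [← card_pos, card_compl]
      lia
    obtain ⟨x, hx, hmin⟩ := exists_min_image _ key hne
    rw [mem_compl] at hx
    refine ⟨insert x I, ?_, card_insert_of_notMem hx⟩
    intro y hy z hz
    by_contra hzI
    rw [mem_insert, not_or] at hzI
    have hzx := hmin z (by simpa using hzI.2)
    rcases mem_insert.1 hy with rfl | hy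
    · exact hzI.1 (key_injective (le_antisymm hz hzx))
    · exact hzI.2 (hI y hy z hz)

lemma sum_lt_sum_of_forall_lt {α : Type*} {f : α → ℕ} {X D : Finset α} (hcard : #X = #D)
    (hX : X.Nonempty) (h : ∀ x ∈ X, ∀ y ∈ D, f x < f y) : ∑ x ∈ X, f x < ∑ y ∈ D, f y := by
  obtain ⟨x, hx, hmax⟩ := exists_max_image X f hX
  have h1 : ∑ x ∈ X, f x ≤ #X • f x := sum_le_card_nsmul X f _ hmax
  have h2 : #D • (f x + 1) ≤ ∑ y ∈ D, f y := card_nsmul_le_sum D f _ fun y hy => h x hx y hy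
  have h3 := card_pos.2 hX
  rw [← hcard, smul_eq_mul, mul_add] at h2
  rw [smul_eq_mul] at h1
  lia

/-- Every point of `I \ T` precedes every point of `T \ I`. The weight `f` is general because a
slice is weighed by the keys of its points after reinsertion. -/
lemma IsInit.sum_lt_sum {I T : Finset (Grid (k + 1) n)} (hI : IsInit I) (hcard : #I = #T)
    (hne : I ≠ T) {f : Grid (k + 1) n → ℕ} (hf : ∀ x y, key x < key y → f x < f y) :
    ∑ x ∈ I, f x < ∑ x ∈ T, f x := by
  have h1 := sum_sdiff_lt_sum_sdiff (s := I) (t := T) (f := f)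
  rw [← h1]
  refine sum_lt_sum_of_forall_lt (card_sdiff_comm hcard) ?_ ?_
  · rw [sdiff_nonempty]
    exact fun h => hne (eq_of_subset_of_card_le h hcard.ge)
  · intro x hx y hy
    rw [mem_sdiff] at hx hy
    refine hf x y (not_le.1 fun h => hy.2 (hI x hx.1 y h))

end Segments

/-! ### Shadows of initial segments -/

section Shadow

lemma mem_dShadow_iff {A : Finset (Grid (k + 1) n)} {z : Grid (k + 1) n} :
    z ∈ dShadow A ↔ ∃ y ∈ A, ∃ j, y j ≠ 0 ∧ update y j 0 = z := by
  simp only [dShadow, pointShadow, mem_biUnion, mem_image, mem_filter, mem_univ, true_and]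
  refine exists_congr fun y => and_congr_right fun _ => exists_congr fun j => ?_
  rw [ne_eq, ne_eq, Fin.ext_iff]
  rfl

lemma dShadow_mono {A B : Finset (Grid (k + 1) n)} (h : A ⊆ B) : dShadow A ⊆ dShadow B :=
  biUnion_subset_biUnion_of_subset_left _ h

lemma rk_lt_of_eq_zero {x : Grid (k + 1) n} {j : Fin n} (h : x j = 0) : rk x < n := by
  unfold rk
  have := card_lt_univ_of_notMem (s := ({j | x j ≠ 0} : Finset (Fin n))) (x := j) (by simpa using h)
  simpa using this

lemma rk_eq_of_forall_ne_zero {x : Grid (k + 1) n} (h : ∀ j, x j ≠ 0) : rk x = n := by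
  unfold rk
  simp [h]

lemma exists_eq_zero_of_rk_lt {x : Grid (k + 1) n} (h : rk x < n) : ∃ j, x j = 0 := by
  by_contra! hc
  exact h.ne (rk_eq_of_forall_ne_zero hc)

lemma eq_of_rk_eq_of_forall {x y : Grid (k + 1) n} (hr : rk x = rk y)
    (h : ∀ j, y j ≠ 0 → x j = y j) : x = y := by
  have hs : ({j | y j ≠ 0} : Finset (Fin n)) = ({j | x j ≠ 0} : Finset (Fin n)) := by
    refine eq_of_subset_of_card_le (fun j hj => ?_) hr.le
    simp only [mem_filter, mem_univ, true_and] at hj ⊢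
    rwa [h j hj]
  ext j
  by_cases hj : y j = 0
  · have := Finset.ext_iff.1 hs j
    simp only [mem_filter, mem_univ, true_and, hj, ne_eq, not_true_eq_false, false_iff,
      not_not] at this
    rw [this, hj]
  · rw [h j hj]

/-- If `z'` precedes a point obtained by zeroing a coordinate of `y`, then `z'` itself arises by
zeroing a coordinate of some point not later than `y`. -/
lemma exists_cover_of_key_lt {y z' : Grid (k + 2) n} {i : Fin n} (hyi : y i ≠ 0)
    (hlt : key z' < key (update y i 0)) : ∃ l, z' l = 0 ∧ key (update z' l 1) ≤ key y := by
  have hry := rk_update_zero hyi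
  have hyn : rk y ≤ n := (card_le_univ _).trans_eq (by simp)
  have h10 : (1 : Fin (k + 2)) ≠ 0 := by simp
  have one_le : ∀ {a : Fin (k + 2)}, a ≠ 0 → 1 ≤ a := fun h => Fin.one_le_of_ne_zero h
  rcases (rk_le_of_key_le hlt.le).lt_or_eq with hr | hr
  · obtain ⟨l, hl⟩ := exists_eq_zero_of_rk_lt (x := z') (by lia)
    exact ⟨l, hl, (key_lt_of_rk_lt (by rw [rk_update_of_eq_zero hl h10]; lia)).le⟩
  obtain ⟨q, hq, hag⟩ := exists_witness_of_key_lt hr hlt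
  have hrk : ∀ l, z' l = 0 → rk (update z' l 1) = rk y := fun l hl => by
    rw [rk_update_of_eq_zero hl h10, hr, hry]
  have hqi : q ≠ i := by rintro rfl; simp at hq
  simp only [update_of_ne hqi] at hq hag
  have hyq : y q ≠ 0 := Fin.ne_zero_of_lt hq
  have hag' : ∀ j, j ≠ i → (y q < z' j ∨ z' j = y q ∧ q < j ∨ y q < y j ∨ y j = y q ∧ q < j) →
      y j = z' j := fun j hj h => by
    have := hag j (by rwa [update_of_ne hj])
    rwa [update_of_ne hj] at this
  have hagi : ¬ (y q < z' i ∨ z' i = y q ∧ q < i) := fun h => by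
    have := hag i (by tauto)
    rw [update_self] at this
    rw [← this] at h
    rcases h with h | h
    · simp at h
    · exact hyq h.1.symm
  -- A `1` placed at such an `l` ranks below `(y q, q)`, so `q` remains a witness.
  by_cases hl : ∃ l, z' l = 0 ∧ (1 < y q ∨ l < q)
  · obtain ⟨l, hl, hlq⟩ := hl
    refine ⟨l, hl, (key_lt_of_witness (hrk l hl) q ?_ ?_).le⟩
    · by_cases h : q = l
      · subst h
        simpa using hlq
      · rwa [update_of_ne h]
    · intro j hj
      by_cases hjl : j = l
      · subst hjl
        rw [update_self] at hj
        exfalso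
        rcases hj with hj | ⟨h1, h2⟩
        · exact (one_le hyq).not_gt hj
        · rcases hlq with h | h
          · exact h.ne h1
          · exact h.not_gt h2
      · rw [update_of_ne hjl] at hj ⊢
        by_cases hji : j = i
        · subst hji
          exact absurd hj hagi
        · exact hag' j hji (by tauto)
  push Not at hl
  obtain ⟨l, hl0⟩ := exists_eq_zero_of_rk_lt (x := z') (by lia)
  have hyq1 : y q = 1 := le_antisymm (hl l hl0).1 (one_le hyq)
  have hzq : z' q = 0 := by
    rw [hyq1] at hq
    by_contra h
    exact (one_le h).not_gt hq
  rw [hyq1] at hag' hagi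
  refine ⟨q, hzq, ?_⟩
  -- Now `y q = 1` and the zero of `z'` at `q` is filled. Either `(y i, i)` ranks above `(1, q)` and
  -- `i` is a witness, or the filled point equals `y`.
  by_cases hi : q < i ∨ 1 < y i
  · refine (key_lt_of_witness (hrk q hzq) i ?_ ?_).le
    · rw [update_of_ne hqi.symm]
      rcases hi with hi | hi
      · refine lt_of_le_of_ne (le_of_not_gt fun h => hagi (Or.inl ((one_le hyi).trans_lt h))) ?_
        intro h
        rcases (one_le hyi).lt_or_eq with h1 | h1
        · exact hagi (Or.inl (h ▸ h1))
        · exact hagi (Or.inr ⟨h.trans h1.symm, hi⟩)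
      · exact (not_lt.1 fun h => hagi (Or.inl h)).trans_lt hi
    · intro j hj
      by_cases hjq : j = q
      · subst hjq
        rw [update_self] at hj ⊢
        exact hyq1
      · rw [update_of_ne hjq] at hj ⊢
        by_cases hji : j = i
        · subst hji
          exfalso
          rcases hj with hj | hj
          · exact hagi (Or.inl ((one_le hyi).trans_lt hj))
          · exact lt_irrefl _ hj.2
        · refine hag' j hji ?_
          rcases hj with hj | ⟨hj1, hj2⟩
          · exact Or.inl ((one_le hyi).trans_lt hj)
          · rcases hi with hi | hi
            · rcases (one_le hyi).lt_or_eq with h1 | h1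
              · exact Or.inl (hj1 ▸ h1)
              · exact Or.inr (Or.inl ⟨hj1.trans h1.symm, hi.trans hj2⟩)
            · exact Or.inl (hj1 ▸ hi)
  · push Not at hi
    have hyi1 : y i = 1 := le_antisymm hi.2 (one_le hyi)
    have hlow : ∀ j, j < q → (1 < z' j → False) → z' j = 1 := fun j hj h => by
      have h0 : z' j ≠ 0 := fun h0 => hj.not_ge (hl j h0).2
      exact le_antisymm (not_lt.1 h) (one_le h0)
    refine (congrArg key (eq_of_rk_eq_of_forall (hrk q hzq) fun j hj => ?_)).le
    by_cases hjq : j = q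
    · subst hjq
      rw [update_self, hyq1]
    rw [update_of_ne hjq]
    by_cases hji : j = i
    · subst hji
      rw [hyi1]
      exact hlow j (lt_of_le_of_ne hi.1 hjq) fun h => hagi (Or.inl h)
    · by_cases h1 : 1 < y j ∨ y j = 1 ∧ q < j
      · exact (hag' j hji (by tauto)).symm
      · push Not at h1
        have hj1 : y j = 1 := le_antisymm h1.1 (one_le hj)
        rw [hj1]
        refine hlow j (lt_of_le_of_ne (h1.2 hj1) hjq) fun h => ?_
        have := hag' j hji (Or.inl h)
        exact h.ne (hj1.symm.trans this)

lemma IsInit.dShadow {B : Finset (Grid (k + 1) n)} (hB : IsInit B) : IsInit (dShadow B) := by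
  intro z hz z' hz'
  rcases hz'.lt_or_eq with h | h
  swap
  · rwa [key_injective h]
  obtain ⟨y, hy, i, hyi, rfl⟩ := mem_dShadow_iff.1 hz
  rcases k with _ | k
  · exact absurd (Subsingleton.elim (α := Fin 1) _ _) hyi
  obtain ⟨l, hl, hle⟩ := exists_cover_of_key_lt hyi h
  refine mem_dShadow_iff.2 ⟨_, hB y hy _ hle, l, by simp, ?_⟩
  rw [update_idem, ← hl, update_eq_self]

end Shadow

/-! ### Slices and their shadows -/

section Slice

/-- The points of `A` having value `v` at position `i`, with that position removed. -/
def slice (A : Finset (Grid (k + 1) (n + 1))) (i : Fin (n + 1)) (v : Fin (k + 1)) :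
    Finset (Grid (k + 1) n) :=
  {s | (i.insertNth v s : Grid (k + 1) (n + 1)) ∈ A}

lemma mem_slice {A : Finset (Grid (k + 1) (n + 1))} {i : Fin (n + 1)} {v : Fin (k + 1)}
    {s : Grid (k + 1) n} : s ∈ slice A i v ↔ (i.insertNth v s : Grid (k + 1) (n + 1)) ∈ A := by
  simp [slice]

lemma sum_eq_sum_slice (A : Finset (Grid (k + 1) (n + 1))) (i : Fin (n + 1))
    (f : Grid (k + 1) (n + 1) → ℕ) :
    ∑ x ∈ A, f x = ∑ v, ∑ s ∈ slice A i v, f (i.insertNth v s) := by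
  simp only [slice, sum_filter]
  rw [← Fintype.sum_prod_type'
      (f := fun v s => if (i.insertNth v s : Grid (k + 1) (n + 1)) ∈ A then
        f (i.insertNth v s) else 0)]
  refine Eq.trans ?_ (Equiv.sum_comp (Fin.insertNthEquiv (fun _ => Fin (k + 1)) i)
    fun x => if x ∈ A then f x else 0).symm
  rw [← sum_filter, filter_mem_eq_inter, univ_inter]

lemma card_eq_sum_slice (A : Finset (Grid (k + 1) (n + 1))) (i : Fin (n + 1)) :
    #A = ∑ v, #(slice A i v) := by
  simpa using sum_eq_sum_slice A i fun _ => 1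

/-- Zeroing another position stays within a slice; zeroing `i` drops a whole slice `u ≠ 0` into
slice `0`. -/
lemma mem_slice_dShadow {A : Finset (Grid (k + 1) (n + 1))} {i : Fin (n + 1)} {v : Fin (k + 1)}
    {s : Grid (k + 1) n} : s ∈ slice (dShadow A) i v ↔
      s ∈ dShadow (slice A i v) ∨ v = 0 ∧ ∃ u ≠ 0, s ∈ slice A i u := by
  simp only [mem_slice, mem_dShadow_iff]
  constructor
  · rintro ⟨y, hy, j, hj, h⟩
    obtain ⟨a, t, rfl⟩ : ∃ a t, y = i.insertNth a t :=
      ⟨_, _, (Fin.insertNth_self_removeNth i y).symm⟩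
    induction j using Fin.succAboveCases i with
    | x =>
      rw [Fin.update_insertNth, Fin.insertNth_inj] at h
      obtain ⟨rfl, rfl⟩ := h
      exact Or.inr ⟨rfl, a, by simpa using hj, hy⟩
    | p j =>
      rw [← Fin.insertNth_update, Fin.insertNth_inj] at h
      obtain ⟨rfl, rfl⟩ := h
      exact Or.inl ⟨t, hy, j, by simpa using hj, rfl⟩
  · rintro (⟨y, hy, j, hj, rfl⟩ | ⟨rfl, u, hu, hs⟩)
    · exact ⟨_, hy, i.succAbove j, by simpa using hj, by rw [Fin.insertNth_update]⟩
    · exact ⟨_, hs, i, by simpa using hu, by rw [Fin.update_insertNth]⟩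

end Slice

/-! ### Improvement by shifting and by slice compression -/

section Compression

/-- `A'` improves on `A`: same size, no larger shadow, and strictly earlier in total. -/
def Improves (A' A : Finset (Grid (k + 1) n)) : Prop :=
  #A' = #A ∧ #(dShadow A') ≤ #(dShadow A) ∧ ∑ x ∈ A', key x < ∑ x ∈ A, key x

/-- Lower the value at position `i` from `v` to `u` unless the result is already in `B`. -/
def shift (B : Finset (Grid (k + 1) n)) (i : Fin n) (u v : Fin (k + 1)) (z : Grid (k + 1) n) :
    Grid (k + 1) n :=
  if z i = v ∧ update z i u ∉ B then update z i u else z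

variable {A B : Finset (Grid (k + 1) n)} {i : Fin n} {u v : Fin (k + 1)}

lemma mem_image_shift_of_ne {z : Grid (k + 1) n} (hz : z ∈ B) (h : z i ≠ v) :
    z ∈ B.image (shift B i u v) :=
  mem_image.2 ⟨z, hz, by simp [shift, h]⟩

lemma mem_image_shift_of_mem {z : Grid (k + 1) n} (hz : z ∈ B) (h : update z i u ∈ B) :
    z ∈ B.image (shift B i u v) :=
  mem_image.2 ⟨z, hz, by simp [shift, h]⟩

lemma mem_image_shift_of_update_mem {z : Grid (k + 1) n} (huv : u ≠ v) (hzi : z i = u)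
    (h : update z i v ∈ B) : z ∈ B.image (shift B i u v) := by
  by_cases hz : z ∈ B
  · exact mem_image_shift_of_ne hz (by rwa [hzi])
  · refine mem_image.2 ⟨_, h, ?_⟩
    have : update z i u = z := by rw [← hzi, update_eq_self]
    simp [shift, this, hz]

lemma shift_injOn : Set.InjOn (shift B i u v) B := by
  intro x hx y hy h
  unfold shift at h
  split_ifs at h with h1 h2 h2
  · have := congrArg (fun z => update z i v) h
    simp only [update_idem] at this
    rwa [← h1.1, update_eq_self, h1.1, ← h2.1, update_eq_self] at this
  · exact absurd (h ▸ hy) h1.2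
  · exact absurd (h ▸ hx) h2.2
  · exact h

/-- Zeroing a position other than `i` commutes with lowering at `i`. Zeroing `i` itself erases the
lowering, and the result is fixed by the shift since `v ≠ 0`. -/
lemma dShadow_image_shift_subset (huv : u < v) :
    dShadow (A.image (shift A i u v)) ⊆ (dShadow A).image (shift (dShadow A) i u v) := by
  have hv : (0 : Fin (k + 1)) ≠ v := (Fin.ne_zero_of_lt huv).symm
  intro z hz
  obtain ⟨w', hw', j, hj, rfl⟩ := mem_dShadow_iff.1 hz
  obtain ⟨w, hw, rfl⟩ := mem_image.1 hw'
  unfold shift at hj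
  rw [shift]
  split_ifs at hj ⊢ with h
  · by_cases hji : j = i
    · subst hji
      rw [update_idem]
      exact mem_image_shift_of_ne
        (mem_dShadow_iff.2 ⟨w, hw, j, by rw [h.1]; exact hv.symm, rfl⟩) (by simpa using hv)
    · refine mem_image_shift_of_update_mem huv.ne (by simp [Ne.symm hji]) ?_
      rw [update_comm hji, update_idem]
      refine mem_dShadow_iff.2 ⟨w, hw, j, by simpa [hji] using hj, ?_⟩
      rw [← h.1, update_eq_self]
  · have hmem : update w j 0 ∈ dShadow A := mem_dShadow_iff.2 ⟨w, hw, j, hj, rfl⟩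
    by_cases hji : j = i
    · subst hji
      exact mem_image_shift_of_ne hmem (by simpa using hv)
    · by_cases hwi : w i = v
      · refine mem_image_shift_of_mem hmem ?_
        have hA : update w i u ∈ A := by tauto
        rw [update_comm hji]
        exact mem_dShadow_iff.2 ⟨_, hA, j, by simpa [hji] using hj, rfl⟩
      · exact mem_image_shift_of_ne hmem (by simpa [Ne.symm hji] using hwi)

/-- A set that is not closed under lowering coordinates can be improved. -/
lemma exists_improves_of_update_notMem {y : Grid (k + 1) n} (hy : y ∈ A) (hu : u < y i)
    (h : update y i u ∉ A) : ∃ A', Improves A' A := by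
  refine ⟨A.image (shift A i u (y i)), card_image_of_injOn shift_injOn,
    (card_le_card (dShadow_image_shift_subset hu)).trans card_image_le, ?_⟩
  rw [sum_image shift_injOn]
  refine sum_lt_sum (fun z _ => ?_) ⟨y, hy, ?_⟩
  · unfold shift
    split_ifs with hz
    · exact (key_update_lt (by rwa [hz.1])).le
    · rfl
  · rw [shift, if_pos ⟨rfl, h⟩]
    exact key_update_lt hu

/-- A set with some slice that is not an initial segment can be improved. -/
lemma exists_improves_of_not_isInit_slice
    (ih : ∀ A B : Finset (Grid (k + 1) n), IsInit B → #B = #A → #(dShadow B) ≤ #(dShadow A))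
    {A : Finset (Grid (k + 1) (n + 1))} {i : Fin (n + 1)} {v : Fin (k + 1)}
    (hv : ¬ IsInit (slice A i v)) : ∃ A', Improves A' A := by
  have hex : ∀ v, ∃ I : Finset (Grid (k + 1) n), IsInit I ∧ #I = #(slice A i v) :=
    fun v => exists_isInit_card (card_le_univ _)
  choose I hI hIcard using hex
  let A' : Finset (Grid (k + 1) (n + 1)) := {x | i.removeNth x ∈ I (x i)}
  have hslice : ∀ v, slice A' i v = I v := fun v => by
    ext s
    rw [mem_slice]
    simp [A']
  refine ⟨A', ?_, ?_, ?_⟩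
  · simp only [card_eq_sum_slice _ i, hslice, hIcard]
  · rw [card_eq_sum_slice (dShadow A') i, card_eq_sum_slice (dShadow A) i]
    refine sum_le_sum fun v _ => ?_
    by_cases h0 : v = 0
    · subst h0
      -- The new slice `0` is a union of initial segments, each no larger than the old one, so all
      -- of them lie in the initial segment `J` of the old size.
      obtain ⟨J, hJ, hJcard⟩ := exists_isInit_card (card_le_univ (slice (dShadow A) i 0))
      rw [← hJcard]
      refine card_le_card fun s hs => ?_
      rw [mem_slice_dShadow, hslice] at hs
      rcases hs with hs | ⟨-, u, hu, hs⟩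
      · refine (hI 0).dShadow.subset_of_card_le hJ ?_ hs
        rw [hJcard]
        exact (ih _ _ (hI 0) (hIcard 0)).trans
          (card_le_card fun t ht => mem_slice_dShadow.2 (Or.inl ht))
      · rw [hslice] at hs
        refine (hI u).subset_of_card_le hJ ?_ hs
        rw [hJcard, hIcard]
        exact card_le_card fun t ht => mem_slice_dShadow.2 (Or.inr ⟨rfl, u, hu, ht⟩)
    · have : ∀ C : Finset (Grid (k + 1) (n + 1)),
          slice (dShadow C) i v = dShadow (slice C i v) := fun C => by
        ext s
        simp [mem_slice_dShadow, h0]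
      rw [this, this, hslice]
      exact ih _ _ (hI v) (hIcard v)
  · rw [sum_eq_sum_slice A' i, sum_eq_sum_slice A i]
    have hlt : ∀ v, I v ≠ slice A i v → ∑ s ∈ I v, key (i.insertNth v s : Grid (k + 1) (n + 1)) <
        ∑ s ∈ slice A i v, key (i.insertNth v s : Grid (k + 1) (n + 1)) := fun v hne =>
      (hI v).sum_lt_sum (hIcard v) hne fun x y => key_insertNth_lt i v
    simp only [hslice]
    refine sum_lt_sum (fun w _ => ?_) ⟨v, mem_univ _, hlt v fun h => hv (h ▸ hI v)⟩
    by_cases h : I w = slice A i w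
    · rw [h]
    · exact (hlt w h).le

end Compression

/-! ### Structure of a gap in a compressed set -/

section Gap

/-- `x` is the first point missing from `A`, `y` is the last point of `A`, `x` precedes `y`, and
`A` is closed under lowering coordinates and under passing to earlier points that share a
coordinate. -/
structure Gap (A : Finset (Grid (k + 1) n)) (x y : Grid (k + 1) n) : Prop where
  update_mem : ∀ z ∈ A, ∀ i u, u ≤ z i → update z i u ∈ A
  mem_of_share : ∀ z ∈ A, ∀ w i, w i = z i → key w ≤ key z → w ∈ A
  notMem : x ∉ A
  mem_of_lt : ∀ w, key w < key x → w ∈ A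
  mem : y ∈ A
  le_of_mem : ∀ w ∈ A, key w ≤ key y
  lt : key x < key y

lemma exists_zero_nonzero_of_rk_lt {x y : Grid (k + 1) n} (h : rk x < rk y) :
    ∃ a, x a = 0 ∧ y a ≠ 0 := by
  obtain ⟨a, ha, hx⟩ := exists_mem_notMem_of_card_lt_card h
  exact ⟨a, by simpa using hx, by simpa using ha⟩

lemma exists_zero_nonzero_of_rk_eq {x y : Grid (k + 1) n} (h : rk x = rk y) {i : Fin n}
    (hx : x i ≠ 0) (hy : y i = 0) : ∃ a, x a = 0 ∧ y a ≠ 0 := by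
  obtain ⟨a, ha, hya⟩ := exists_zero_nonzero_of_rk_lt (x := x) (y := update y i (x i))
    (by rw [rk_update_of_eq_zero hy hx]; lia)
  have hai : a ≠ i := by rintro rfl; exact hx ha
  exact ⟨a, ha, by simpa [hai] using hya⟩

lemma improves_swap {A : Finset (Grid (k + 1) n)} {x y : Grid (k + 1) n} (hx : x ∉ A) (hy : y ∈ A)
    (hlt : key x < key y) (h : ∀ i, x i ≠ 0 → update x i 0 ∈ dShadow A) :
    Improves (insert x (A.erase y)) A := by
  have hx' : x ∉ A.erase y := fun h => hx (mem_of_mem_erase h)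
  refine ⟨?_, card_le_card fun z hz => ?_, ?_⟩
  · rw [card_insert_of_notMem hx', card_erase_add_one hy]
  · obtain ⟨w, hw, i, hi, rfl⟩ := mem_dShadow_iff.1 hz
    rcases mem_insert.1 hw with rfl | hw
    · exact h i hi
    · exact mem_dShadow_iff.2 ⟨w, mem_of_mem_erase hw, i, hi, rfl⟩
  · rw [sum_insert hx', ← add_sum_erase A key hy]
    lia

namespace Gap

variable {A : Finset (Grid (k + 2) n)} {x y : Grid (k + 2) n}

/-- Membership passes from `y` to `w` through `b`, then from `w` to `x` through `a`. -/
lemma false_of_between (g : Gap A x y) {w : Grid (k + 2) n} (a b : Fin n) (ha : w a = x a)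
    (hb : w b = y b) (hxw : key x < key w) (hwy : key w ≤ key y) : False :=
  g.notMem (g.mem_of_share w (g.mem_of_share y g.mem w b hb hwy) x a ha.symm hxw.le)

lemma ne (g : Gap A x y) (j : Fin n) : x j ≠ y j :=
  fun h => g.notMem (g.mem_of_share y g.mem x j h g.lt.le)

lemma false_of_update (g : Gap A x y) (i : Fin n) (h : x i ≤ y i)
    (hle : key x ≤ key (update y i (x i))) : False :=
  g.notMem (g.mem_of_share _ (g.update_mem y g.mem i _ h) x i (by simp) hle)

/-- Only the value `1` in the initial zero-free part of `x` can give new shadow. -/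
lemma update_mem_dShadow (g : Gap A x y) {i : Fin n} (hi : x i ≠ 0)
    (h : ¬ (x i = 1 ∧ ∀ j < i, x j ≠ 0)) : update x i 0 ∈ dShadow A := by
  have h10 : (1 : Fin (k + 2)) ≠ 0 := by simp
  by_cases h1 : x i = 1
  · push Not at h
    obtain ⟨j, hji, hj⟩ := h h1
    -- Moving the `1` from `i` to the earlier zero `j` gives a point before `x`, hence in `A`, with
    -- the same shadow point.
    refine mem_dShadow_iff.2 ⟨update (update x i 0) j 1, g.mem_of_lt _ ?_, j, by simp, ?_⟩
    · refine key_lt_of_witness (rk_update_update hi hj h10) i ?_ ?_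
      · rw [update_of_ne hji.ne', update_self]
        exact Fin.pos_of_ne_zero hi
      · intro l hl
        rw [h1] at hl
        by_cases hlj : l = j
        · subst hlj
          simp [hji.not_gt] at hl
        · by_cases hli : l = i
          · subst hli
            simp [hlj] at hl
          · rw [update_of_ne hlj, update_of_ne hli]
    · rw [update_idem, update_eq_self_iff, update_of_ne hji.ne, hj]
  · have hlt : 1 < x i := lt_of_le_of_ne (Fin.one_le_of_ne_zero hi) (Ne.symm h1)
    exact mem_dShadow_iff.2
      ⟨update x i 1, g.mem_of_lt _ (key_update_lt hlt), i, by simp, by rw [update_idem]⟩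

/-- Lowering single entries of `y` forces `rk y = rk x + 1` and `y i = 0`. Then replacing a later
entry of `y` by a `1` at `i` gives a point between `x` and `y`. -/
lemma false_of_rk_lt (g : Gap A x y) (hr : rk x < rk y) {i : Fin n} (hi : x i = 1)
    (hpre : ∀ j < i, x j ≠ 0) : False := by
  have h10 : (1 : Fin (k + 2)) ≠ 0 := by simp
  have hi0 : x i ≠ 0 := by rw [hi]; exact h10
  obtain ⟨a, hxa, hya⟩ := exists_zero_nonzero_of_rk_lt hr
  have hr1 : rk y = rk x + 1 := by
    by_contra hne
    have := rk_update_zero hya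
    refine g.false_of_update a (by rw [hxa]; exact Fin.zero_le _) (key_lt_of_rk_lt ?_).le
    rw [hxa]
    lia
  have hyi : y i = 0 := by
    by_contra hyi
    refine g.false_of_update i (by rw [hi]; exact Fin.one_le_of_ne_zero hyi)
      (key_lt_of_rk_lt ?_).le
    rwa [hi, rk_update_of_ne_zero hyi h10]
  have hia : i ≠ a := by rintro rfl; exact hi0 hxa
  obtain ⟨b, hxb, hyb⟩ := exists_zero_nonzero_of_rk_eq (x := update x a 1) (y := y)
    (by rw [rk_update_of_eq_zero hxa h10, hr1]) (i := i) (by rwa [update_of_ne hia]) hyi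
  have hba : b ≠ a := by rintro rfl; simp at hxb
  have hbi : b ≠ i := by rintro rfl; exact hyb hyi
  have hlt : i < a := lt_of_le_of_ne (not_lt.1 fun h => hpre a h hxa) hia
  have hrw := rk_update_update hya hyi h10
  refine g.false_of_between (w := update (update y a 0) i 1) i b (by simp [hi])
    (by simp [hbi, hba]) (key_lt_of_rk_lt (by rwa [hrw]))
    (key_lt_of_witness hrw a ?_ fun j hj => ?_).le
  · rw [update_of_ne hia.symm, update_self]
    exact Fin.pos_of_ne_zero hya
  · by_cases hji : j = i
    · subst hji
      rw [update_self] at hj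
      rcases hj with hj | hj
      · exact absurd hj (Fin.one_le_of_ne_zero hya).not_gt
      · exact absurd hj.2 hlt.not_gt
    · by_cases hja : j = a
      · subst hja
        simp [hji] at hj
      · rw [update_of_ne hji, update_of_ne hja]

variable {p i : Fin n}

/-- The top difference between `x` and `y` dominates every value, since `x` and `y` share no
coordinate. -/
lemma top_bounds (g : Gap A x y) (hp : x p < y p)
    (hag : ∀ j, y p < x j ∨ x j = y p ∧ p < j ∨ y p < y j ∨ y j = y p ∧ p < j → y j = x j) :
    (∀ j, x j ≤ y p) ∧ (∀ j, x j = y p → j < p) ∧ (∀ j, y j ≤ y p) ∧ ∀ j, y j = y p → j ≤ p := by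
  refine ⟨fun j => ?_, fun j h => ?_, fun j => ?_, fun j h => ?_⟩ <;> by_contra hc
  · exact g.ne j (hag j (Or.inl (not_le.1 hc))).symm
  · rcases (not_lt.1 hc).lt_or_eq with h' | rfl
    · exact g.ne j (hag j (Or.inr (Or.inl ⟨h, h'⟩))).symm
    · exact hp.ne h
  · exact g.ne j (hag j (Or.inr (Or.inr (Or.inl (not_le.1 hc))))).symm
  · exact g.ne j (hag j (Or.inr (Or.inr (Or.inr ⟨h, not_le.1 hc⟩)))).symm

lemma key_lt_of_top {w : Grid (k + 2) n} (hp : x p < y p) (hx : ∀ j, x j ≤ y p)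
    (hxp : ∀ j, x j = y p → j < p) (hr : rk x = rk w) (hw : w p = y p) : key x < key w := by
  refine key_lt_of_witness hr p (by rwa [hw]) fun j hj => ?_
  rw [hw] at hj
  rcases hj with hj | hj
  · exact absurd hj (hx j).not_gt
  · exact absurd hj.2 (hxp j hj.1).not_gt

/-- Moving an entry of `y` to `i` shows that `x` vanishes only at `p`; counting shows that `y`
vanishes only at `i`. A third position gives a contradiction, so only `i` and `p` exist, and the
shadow point is zero, which also lies below `y`. -/
lemma update_mem_dShadow_of_eq_zero (g : Gap A x y) (hr : rk x = rk y) (hp : x p < y p)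
    (hag : ∀ j, y p < x j ∨ x j = y p ∧ p < j ∨ y p < y j ∨ y j = y p ∧ p < j → y j = x j)
    (hi : x i = 1) (hpre : ∀ j < i, x j ≠ 0) (hyi : y i = 0) : update x i 0 ∈ dShadow A := by
  obtain ⟨hx, hxp, hy, hyp⟩ := g.top_bounds hp hag
  have h10 : (1 : Fin (k + 2)) ≠ 0 := by simp
  have hi0 : x i ≠ 0 := by rw [hi]; exact h10
  have hyp0 : y p ≠ 0 := Fin.ne_zero_of_lt hp
  have hip : i ≠ p := by rintro rfl; exact hyp0 hyi
  -- moving a nonzero entry of `y` to the value `1` at position `i`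
  have move : ∀ a, a ≠ p → y a ≠ 0 → (1 < y a ∨ i < a) → False := by
    intro a hap hya hcond
    have hai : a ≠ i := by rintro rfl; exact hya hyi
    have hrw := rk_update_update hya hyi h10
    refine g.false_of_between (w := update (update y a 0) i 1) i p (by simp [hi])
      (by simp [hip.symm, hap.symm])
      (key_lt_of_top hp hx hxp (hr.trans hrw.symm) (by simp [hip.symm, hap.symm]))
      (key_lt_of_witness hrw a ?_ fun j hj => ?_).le
    · rw [update_of_ne hai, update_self]
      exact Fin.pos_of_ne_zero hya
    · by_cases hji : j = i
      · subst hji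
        rw [update_self] at hj
        exfalso
        rcases hj with hj | hj
        · exact hj.not_ge (Fin.one_le_of_ne_zero hya)
        · rcases hcond with h | h
          · exact h.ne hj.1
          · exact h.not_gt hj.2
      · by_cases hja : j = a
        · subst hja
          simp [hji] at hj
        · rw [update_of_ne hji, update_of_ne hja]
  have hxz : ∀ a, a ≠ p → x a ≠ 0 := by
    intro a hap hxa
    refine move a hap (fun h => g.ne a (hxa.trans h.symm)) (Or.inr ?_)
    refine lt_of_le_of_ne (not_lt.1 fun h => hpre a h hxa) ?_
    rintro rfl
    exact hi0 hxa
  have hxp0 : x p = 0 := by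
    obtain ⟨a, ha, -⟩ := exists_zero_nonzero_of_rk_eq hr hi0 hyi
    by_cases hap : a = p
    · rwa [← hap]
    · exact absurd ha (hxz a hap)
  have hyz : ∀ j, j ≠ i → y j ≠ 0 := by
    intro j hji hyj
    have h1 : rk (update y i 1) < n := rk_lt_of_eq_zero (j := j) (by rwa [update_of_ne hji])
    have h2 : rk (update x p 1) = n := rk_eq_of_forall_ne_zero fun j => by
      by_cases hjp : j = p
      · subst hjp; simp
      · rw [update_of_ne hjp]; exact hxz j hjp
    rw [rk_update_of_eq_zero hyi h10] at h1
    rw [rk_update_of_eq_zero hxp0 h10] at h2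
    lia
  by_cases hex : ∃ j, j ≠ i ∧ j ≠ p
  · exfalso
    have hrest : ∀ j, j ≠ i → j ≠ p → y j = 1 ∧ j < i := by
      intro j hji hjp
      have h1 : ¬ (1 < y j ∨ i < j) := move j hjp (hyz j hji)
      push Not at h1
      exact ⟨le_antisymm h1.1 (Fin.one_le_of_ne_zero (hyz j hji)), lt_of_le_of_ne h1.2 hji⟩
    obtain ⟨j, hji, hjp⟩ := hex
    have hilt : i < p := by
      refine lt_of_le_of_ne (not_lt.1 fun h => hpre p h hxp0) hip
    have hrw := rk_update_update hyp0 hyi hyp0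
    have hM : 1 < y p := by
      have h1 := hx j
      have h2 := g.ne j
      have h3 := Fin.one_le_of_ne_zero (hxz j hjp)
      rw [(hrest j hji hjp).1] at h2
      exact (lt_of_le_of_ne h3 h2.symm).trans_le h1
    -- Here the top entry itself moves from `p` down to `i`: `w` shares the zero at `p` with `x` and
    -- the entry at `j` with `y`.
    refine g.false_of_between (w := update (update y p 0) i (y p)) p j
      (by simp [hip.symm, hxp0]) (by simp [hji, hjp])
      (key_lt_of_witness (hr.trans hrw.symm) i (by simpa [hi] using hM) fun l hl => ?_)
      (key_lt_of_witness hrw p ?_ fun l hl => ?_).le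
    · exfalso
      rw [update_self] at hl
      rcases hl with hl | hl
      · exact hl.not_ge (hx l)
      · by_cases hlp : l = p
        · subst hlp
          exact hp.ne hl.1
        · exact hl.2.not_gt (hrest l hl.2.ne' hlp).2
    · rw [update_of_ne hip.symm, update_self]
      exact Fin.pos_of_ne_zero hyp0
    · by_cases hli : l = i
      · subst hli
        simp [hilt.not_gt] at hl
      · by_cases hlp : l = p
        · subst hlp
          simp [hli] at hl
        · rw [update_of_ne hli, update_of_ne hlp]
  · push Not at hex
    refine mem_dShadow_iff.2 ⟨y, g.mem, p, hyp0, ?_⟩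
    ext j
    by_cases hji : j = i
    · subst hji
      rw [update_self, update_of_ne hip, hyi]
    · have := hex j hji
      subst this
      rw [update_self, update_of_ne hji, hxp0]

/-- Lowering `y` away from `p` to a nonzero entry of `x` keeps the top entry, hence stays after `x`,
and is impossible. This gives `i = p` and the domination once `x` is known to have no zero. -/
lemma dominated_of_one_lt (g : Gap A x y) (hr : rk x = rk y) (hp : x p < y p)
    (hag : ∀ j, y p < x j ∨ x j = y p ∧ p < j ∨ y p < y j ∨ y j = y p ∧ p < j → y j = x j)
    (hi : x i = 1) (hpre : ∀ j < i, x j ≠ 0) (hyi : 1 < y i) :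
    i = p ∧ ∀ j, y j ≠ 0 ∧ (j ≠ p → y j < x j) := by
  obtain ⟨hx, hxp, hy, hyp⟩ := g.top_bounds hp hag
  have h10 : (1 : Fin (k + 2)) ≠ 0 := by simp
  have hyp0 : y p ≠ 0 := Fin.ne_zero_of_lt hp
  -- lowering `y` at a position other than `p` to a nonzero entry of `x`
  have lower : ∀ j, j ≠ p → x j ≠ 0 → x j ≤ y j → False := by
    intro j hjp hxj hle
    have hyj : y j ≠ 0 := by
      intro h
      rw [h] at hle
      exact hxj (le_antisymm hle (Fin.zero_le _))
    exact g.false_of_update j hle (key_lt_of_top hp hx hxp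
      (by rw [hr, rk_update_of_ne_zero hyj hxj]) (by rw [update_of_ne hjp.symm])).le
  obtain rfl : i = p := by
    by_contra hip
    exact lower i hip (by rw [hi]; exact h10) (by rw [hi]; exact hyi.le)
  have hxz : ∀ a, x a ≠ 0 := by
    intro a hxa
    have hai : a ≠ i := by rintro rfl; rw [hi] at hxa; exact h10 hxa
    have hia : i < a := lt_of_le_of_ne (not_lt.1 fun h => hpre a h hxa) hai.symm
    have hya : y a ≠ 0 := fun h => g.ne a (hxa.trans h.symm)
    obtain ⟨b, hyb⟩ := exists_eq_zero_of_rk_lt (x := y) (by rw [← hr]; exact rk_lt_of_eq_zero hxa)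
    have hba : b ≠ a := by rintro rfl; exact hya hyb
    have hbi : b ≠ i := by rintro rfl; exact hyp0 hyb
    have hrw : rk (update (update x i 0) a (y a)) = rk x :=
      rk_update_update (by rw [hi]; exact h10) hxa hya
    -- Here `w` is built from `x`, trading its `1` at `i` for `y a` at `a`. The zero `b` of `y`
    -- serves as a third position, where `w` still agrees with `x`.
    refine g.false_of_between (w := update (update x i 0) a (y a)) b a (by simp [hba, hbi])
      (by simp) (key_lt_of_witness hrw.symm a ?_ fun j hj => ?_)
      (key_lt_of_witness (hrw.trans hr) i ?_ fun j hj => ?_).le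
    · rw [update_self, hxa]
      exact Fin.pos_of_ne_zero hya
    · rw [update_self] at hj
      have hji : j ≠ i := by
        rintro rfl
        rw [hi] at hj
        rcases hj with hj | hj
        · exact hj.not_ge (Fin.one_le_of_ne_zero hya)
        · exact hj.2.not_gt hia
      have hja : j ≠ a := by
        rintro rfl
        simp [hxa] at hj
      rw [update_of_ne hja, update_of_ne hji]
    · rw [update_of_ne hai.symm, update_self]
      exact Fin.pos_of_ne_zero hyp0
    · exfalso
      by_cases hja : j = a
      · subst hja
        rw [update_self] at hj
        rcases hj with hj | hj
        · exact hj.not_ge (hy j)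
        · exact (hyp j hj.1).not_gt hj.2
      · by_cases hji : j = i
        · subst hji
          simp [hja] at hj
        · rw [update_of_ne hja, update_of_ne hji] at hj
          rcases hj with hj | hj
          · exact hj.not_ge (hx j)
          · exact (hxp j hj.1).not_gt hj.2
  refine ⟨rfl, fun j => ⟨fun h => ?_, fun hji => not_le.1 fun h => lower j hji (hxz j) h⟩⟩
  have := rk_lt_of_eq_zero h
  rw [← hr, rk_eq_of_forall_ne_zero hxz] at this
  exact lt_irrefl _ this

end Gap

end Gap

/-! ### The line exchange and the descent -/

section Main

namespace Gap

/-- Replace a line segment of `A` ending at `y` by a segment starting at `x`. -/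
lemma exists_improves_of_dominated {A : Finset (Grid (k + 2) n)} {x y : Grid (k + 2) n} {p : Fin n}
    (g : Gap A x y) (hp : x p < y p)
    (hag : ∀ j, y p < x j ∨ x j = y p ∧ p < j ∨ y p < y j ∨ y j = y p ∧ p < j → y j = x j)
    (hxp1 : x p = 1) (hdom : ∀ j, y j ≠ 0 ∧ (j ≠ p → y j < x j)) : ∃ A', Improves A' A := by
  obtain ⟨hx, hxp, hy, hyp⟩ := g.top_bounds hp hag
  have h10 : (1 : Fin (k + 2)) ≠ 0 := by simp
  have hx0 : ∀ j, x j ≠ 0 := fun j => by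
    by_cases hj : j = p
    · rw [hj, hxp1]; exact h10
    · exact Fin.ne_zero_of_lt ((hdom j).2 hj)
  have hrx : rk x = n := rk_eq_of_forall_ne_zero hx0
  have hry : rk y = n := rk_eq_of_forall_ne_zero fun j => (hdom j).1
  have hne : (univ.erase p).Nonempty := by
    by_contra h
    rw [not_nonempty_iff_eq_empty] at h
    have : update y p (x p) = x := by
      ext j
      have : j = p := by
        by_contra hj
        exact notMem_empty j (h ▸ mem_erase.2 ⟨hj, mem_univ j⟩)
      rw [this, update_self]
    exact g.notMem (this ▸ g.update_mem y g.mem p _ hp.le)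
  -- Minimality makes every entry of `x` away from `p` exceed `y j`, so placing any of `1, …, y j`
  -- at `p` creates no new shadow except by zeroing `p`.
  obtain ⟨j, hj, hmin⟩ := exists_min_image _ x hne
  have hjp : j ≠ p := ne_of_mem_erase hj
  have hlow : ∀ l, l ≠ p → y j < x l := fun l hl =>
    ((hdom j).2 hjp).trans_le (hmin l (mem_erase.2 ⟨hl, mem_univ l⟩))
  have hcp : y j < y p := ((hdom j).2 hjp).trans_le (hx j)
  have hc1 : 1 ≤ y j := Fin.one_le_of_ne_zero (hdom j).1
  have hpos : ∀ {v}, v ∈ Icc 1 (y j) → v ≠ 0 := fun h h0 => by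
    rw [h0, mem_Icc] at h
    exact h10 (le_antisymm h.1 (Fin.zero_le _))
  set D := (Icc 1 (y j)).image (update y j) with hD
  set X := (Icc 1 (y j)).image (update x p) with hX
  have hDA : D ⊆ A := by
    intro z hz
    obtain ⟨v, hv, rfl⟩ := mem_image.1 hz
    exact g.update_mem y g.mem j v (mem_Icc.1 hv).2
  have hXA : Disjoint (A \ D) X := by
    rw [disjoint_right]
    intro z hz hzA
    obtain ⟨v, hv, rfl⟩ := mem_image.1 hz
    have := g.update_mem _ (mem_sdiff.1 hzA).1 p 1 (by rw [update_self]; exact (mem_Icc.1 hv).1)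
    rw [update_idem, ← hxp1, update_eq_self] at this
    exact g.notMem this
  have hcard : #X = #D := by
    rw [hX, hD, card_image_of_injective _ (update_injective _ _),
      card_image_of_injective _ (update_injective _ _)]
  have hXne : X.Nonempty := ⟨_, mem_image_of_mem _ (mem_Icc.2 ⟨le_rfl, hc1⟩)⟩
  refine ⟨(A \ D) ∪ X, ?_, ?_, ?_⟩
  · rw [card_union_of_disjoint hXA, hcard, card_sdiff_add_card_eq_card hDA]
  · set ζ := update y j 0 with hζ
    have hζA : ζ ∈ dShadow A := mem_dShadow_iff.2 ⟨y, g.mem, j, (hdom j).1, rfl⟩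
    have hsub : dShadow ((A \ D) ∪ X) ⊆ insert (update x p 0) (dShadow A) := by
      intro z hz
      obtain ⟨w, hw, l, hl, rfl⟩ := mem_dShadow_iff.1 hz
      rcases mem_union.1 hw with hw | hw
      · exact mem_insert_of_mem (mem_dShadow_iff.2 ⟨w, (mem_sdiff.1 hw).1, l, hl, rfl⟩)
      obtain ⟨v, hv, rfl⟩ := mem_image.1 hw
      by_cases hlp : l = p
      · rw [hlp, update_idem]
        exact mem_insert_self _ _
      refine mem_insert_of_mem (mem_dShadow_iff.2
        ⟨update (update x p v) l 1, g.mem_of_lt _ ?_, l, by simp, by rw [update_idem]⟩)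
      refine key_lt_of_witness ?_ l ?_ fun q hq => ?_
      · rw [rk_update_of_ne_zero hl h10, rk_update_of_ne_zero (hx0 p) (hpos hv)]
      · rw [update_self]
        exact hc1.trans_lt (hlow l hlp)
      · by_cases hql : q = l
        · subst hql
          rw [update_self] at hq
          rcases hq with hq | hq
          · exact absurd hq (hc1.trans_lt (hlow q hlp)).not_gt
          · exact absurd hq.2 (lt_irrefl q)
        · rw [update_of_ne hql] at hq ⊢
          by_cases hqp : q = p
          · subst hqp
            rw [update_self] at hq
            have hvl : v < x l := (mem_Icc.1 hv).2.trans_lt (hlow l hlp)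
            rcases hq with hq | hq
            · exact absurd hq hvl.not_gt
            · exact absurd hq.1 hvl.ne
          · rw [update_of_ne hqp]
    have hζ' : ζ ∉ dShadow ((A \ D) ∪ X) := by
      intro h
      obtain ⟨w, hw, l, hl, hwl⟩ := mem_dShadow_iff.1 h
      obtain rfl : l = j := by
        by_contra hlj
        have := congrFun hwl l
        rw [update_self, hζ, update_of_ne hlj] at this
        exact (hdom l).1 this.symm
      have hwy : w = update y l (w l) := by
        have := congrArg (fun z => update z l (w l)) hwl
        simpa [hζ] using this
      have hwp : w p = y p := by rw [hwy, update_of_ne hjp.symm]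
      rcases mem_union.1 hw with hw | hw
      · rw [mem_sdiff] at hw
        refine hw.2 (mem_image.2 ⟨w l, mem_Icc.2 ⟨Fin.one_le_of_ne_zero hl, ?_⟩, hwy.symm⟩)
        -- A point of `A` over `ζ` with a larger value at `l` would come after `y`.
        by_contra hlt
        have h1 : key (update w l (y l)) < key w := key_update_lt (not_le.1 hlt)
        rw [hwy, update_idem, update_eq_self, ← hwy] at h1
        exact h1.not_ge (g.le_of_mem w hw.1)
      · obtain ⟨v, hv, rfl⟩ := mem_image.1 hw
        rw [update_self] at hwp
        exact ((mem_Icc.1 hv).2.trans_lt hcp).ne hwp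
    calc #(dShadow ((A \ D) ∪ X)) ≤ #((insert (update x p 0) (dShadow A)).erase ζ) :=
          card_le_card (subset_erase.2 ⟨hsub, hζ'⟩)
      _ = #(insert (update x p 0) (dShadow A)) - 1 :=
          card_erase_of_mem (mem_insert_of_mem hζA)
      _ ≤ #(dShadow A) := by
          have := card_insert_le (update x p 0) (dShadow A)
          lia
  · rw [sum_union hXA, ← sum_sdiff hDA]
    refine Nat.add_lt_add_left (sum_lt_sum_of_forall_lt hcard hXne ?_) _
    intro a ha b hb
    obtain ⟨v, hv, rfl⟩ := mem_image.1 ha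
    obtain ⟨u, hu, rfl⟩ := mem_image.1 hb
    have hyp' : update y j u p = y p := update_of_ne hjp.symm _ _
    refine key_lt_of_witness ?_ p ?_ fun q hq => ?_
    · rw [rk_update_of_ne_zero (hx0 p) (hpos hv), rk_update_of_ne_zero (hdom j).1 (hpos hu), hrx,
        hry]
    · rw [hyp', update_self]
      exact (mem_Icc.1 hv).2.trans_lt hcp
    · exfalso
      rw [hyp'] at hq
      by_cases hqp : q = p
      · subst hqp
        rw [update_self] at hq
        rcases hq with hq | hq
        · exact hq.not_gt ((mem_Icc.1 hv).2.trans_lt hcp)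
        · exact lt_irrefl q hq.2
      · rw [update_of_ne hqp] at hq
        rcases hq with hq | hq
        · exact hq.not_ge (hx q)
        · exact (hxp q hq.1).not_gt hq.2

lemma exists_improves {A : Finset (Grid (k + 1) n)} {x y : Grid (k + 1) n} (g : Gap A x y) :
    ∃ A', Improves A' A := by
  rcases k with _ | k
  · have : x = y := funext fun j => Subsingleton.elim (α := Fin 1) _ _
    exact absurd g.mem (this ▸ g.notMem)
  by_cases hsh : ∀ i, x i ≠ 0 → update x i 0 ∈ dShadow A
  · exact ⟨_, improves_swap g.notMem g.mem g.lt hsh⟩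
  push Not at hsh
  obtain ⟨i, hi, hnot⟩ := hsh
  obtain ⟨hi1, hpre⟩ := not_not.1 fun h => hnot (g.update_mem_dShadow hi h)
  rcases (rk_le_of_key_le g.lt.le).lt_or_eq with hr | hr
  · exact (g.false_of_rk_lt hr hi1 hpre).elim
  obtain ⟨p, hp, hag⟩ := exists_witness_of_key_lt hr g.lt
  have hyi : y i ≠ 0 := fun h => hnot (g.update_mem_dShadow_of_eq_zero hr hp hag hi1 hpre h)
  have hyi1 : 1 < y i := lt_of_le_of_ne (Fin.one_le_of_ne_zero hyi) (hi1 ▸ g.ne i)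
  obtain ⟨rfl, hdom⟩ := g.dominated_of_one_lt hr hp hag hi1 hpre hyi1
  exact g.exists_improves_of_dominated hp hag hi1 hdom

end Gap

/-- Slices need positive dimension, so they enter only through `hshare`, which is vacuous for `n =
0`. -/
lemma exists_improves_of_not_isInit {A : Finset (Grid (k + 1) n)} (hA : ¬ IsInit A)
    (hshare : ∀ z ∈ A, ∀ w i, w i = z i → key w ≤ key z → w ∉ A → ∃ A', Improves A' A) :
    ∃ A', Improves A' A := by
  by_contra hno
  simp only [IsInit, not_forall] at hA
  obtain ⟨y₀, hy₀, x₀, hle, hx₀⟩ := hA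
  obtain ⟨x, hx, hxmin⟩ := exists_min_image Aᶜ key ⟨x₀, mem_compl.2 hx₀⟩
  obtain ⟨y, hy, hymax⟩ := exists_max_image A key ⟨y₀, hy₀⟩
  rw [mem_compl] at hx
  have hxy : key x ≤ key y := (hxmin x₀ (mem_compl.2 hx₀)).trans (hle.trans (hymax y₀ hy₀))
  refine hno (Gap.exists_improves (x := x) (y := y) ⟨fun z hz i u hu => ?_,
    fun z hz w i h hwz => not_not.1 fun hw => hno (hshare z hz w i h hwz hw), hx,
    fun w hw => not_not.1 fun hwA => (hxmin w (mem_compl.2 hwA)).not_gt hw, hy, hymax,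
    lt_of_le_of_ne hxy fun h => hx (key_injective h ▸ hy)⟩)
  rcases hu.lt_or_eq with hu | rfl
  · exact not_not.1 fun h => hno (exists_improves_of_update_notMem hz hu h)
  · rwa [update_eq_self]

/-- The total key drops at each improvement, so the process ends at an initial segment of the size
of `B`. -/
lemma card_dShadow_le_of_forall_exists_improves {A B : Finset (Grid (k + 1) n)}
    (h : ∀ A : Finset (Grid (k + 1) n), ¬ IsInit A → ∃ A', Improves A' A) (hB : IsInit B)
    (hcard : #B = #A) : #(dShadow B) ≤ #(dShadow A) := by
  induction hs : ∑ x ∈ A, key x using Nat.strong_induction_on generalizing A with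
  | _ s ih =>
    by_cases hA : IsInit A
    · exact card_le_card (dShadow_mono (hB.subset_of_card_le hA hcard.le))
    · obtain ⟨A', h1, h2, h3⟩ := h A hA
      exact (ih _ (hs ▸ h3) (hcard.trans h1.symm) rfl).trans h2

lemma card_dShadow_le_of_isInit {A B : Finset (Grid (k + 1) n)} (hB : IsInit B)
    (hcard : #B = #A) : #(dShadow B) ≤ #(dShadow A) := by
  induction n with
  | zero =>
    exact card_dShadow_le_of_forall_exists_improves
      (fun A hA => exists_improves_of_not_isInit hA fun _ _ _ i => i.elim0) hB hcard
  | succ n ih =>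
    refine card_dShadow_le_of_forall_exists_improves (fun A hA =>
      exists_improves_of_not_isInit hA fun z hz w i h hwz hw => ?_) hB hcard
    refine exists_improves_of_not_isInit_slice (fun A B hB hcard => ih hB hcard) (i := i)
      (v := z i) fun hinit => hw ?_
    obtain ⟨a, s, rfl⟩ : ∃ a s, z = i.insertNth a s :=
      ⟨_, _, (Fin.insertNth_self_removeNth i z).symm⟩
    obtain ⟨b, t, rfl⟩ : ∃ a s, w = i.insertNth a s :=
      ⟨_, _, (Fin.insertNth_self_removeNth i w).symm⟩
    simp only [Fin.insertNth_apply_same] at h hinit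
    subst h
    exact mem_slice.1 (hinit s (mem_slice.2 hz) t
      (not_lt.1 fun hlt => (key_insertNth_lt i b hlt).not_ge hwz))

end Main

end KGrid

theorem theorem1 (k n : ℕ) (A B : Finset (KGrid.Grid k n))
    (hB : KGrid.IsInitialSegment B) (hcard : B.card = A.card) :
    (KGrid.dShadow B).card ≤ (KGrid.dShadow A).card := by
  rcases k with _ | k
  · rw [Finset.card_eq_zero.2]
    · exact Nat.zero_le _
    · refine Finset.eq_empty_of_forall_notMem fun z hz => ?_
      simp only [KGrid.dShadow, KGrid.pointShadow, Finset.mem_biUnion, Finset.mem_image] at hz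
      obtain ⟨x, -, j, -⟩ := hz
      exact (x j).elim0
  · exact KGrid.card_dShadow_le_of_isInit hB.isInit hcard
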